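/- Let $\mathbb{A}=(a_{ij})_{i,j\in I}$, $I=\{1,\dots,n\}$, be a symmetrizable generalized Cartan matrix: an integer matrix with $a_{ii}=2$, $a_{ij}\le 0$ for $i\ne j$, $a_{ij}=0$ if and only if $a_{ji}=0$, and $\mathbb{A}=DB$ with $D$ a real diagonal and $B$ a real symmetric matrix. Let $\Lambda$ be a free $\mathbb{Z}$-module of finite rank $d$ with dual $\Lambda^\vee$, and let $\alpha_1,\dots,\alpha_n\in\Lambda$ and $\alpha_1^\vee,\dots,\alpha_n^\vee\in\Lambda^\vee$ be two linearly independent families with $\langle\alpha_j,\alpha_i^\vee\rangle=a_{ij}$ for all $i,j\in I$ (a free and cofree Kac–Moody root datum). Put $\mathfrak{a}:=\Lambda^\vee\otimes_{\mathbb{Z}}\mathbb{R}$, extend $\alpha_1^\vee,\dots,\alpha_n^\vee$ to an $\mathbb{R}$-basis $\{\alpha_1^\vee,\dots,\alpha_n^\vee,h_{n+1},\dots,h_d\}$ of $\mathfrak{a}$, and let $\{\omega_1,\dots,\omega_n,\phi_{n+1},\dots,\phi_d\}\subset\mathfrak{a}^*$ be the dual basis. Let $W$ be the Weyl group, i.e.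 the group with generators $s_i$ ($i\in I$) and relations $s_i^2=1$ and $(s_is_j)^{m_{ij}}=1$ for $i\neq j$, where $m_{ij}=2,3,4,6,\infty$ according as $a_{ij}a_{ji}=0,1,2,3$ or $\ge 4$ (no relation if $m_{ij}=\infty$), acting linearly on $\mathfrak{a}$ by $s_i(x)=x-\langle\alpha_i,x\rangle\alpha_i^\vee$. Let $C:=\{x\in\mathfrak{a}:\langle\alpha_i,x\rangle>0\ \text{for all } i\in I\}$ be the open fundamental chamber and, for $h\in\mathfrak{a}$, let $\Xi_h:=\operatorname{conv}(W\cdot h)$ be the convex hull of the $W$-orbit of $h$. If $h\in C$, then a point $h'\in\mathfrak{a}$ lies in $\Xi_h$ if and only if $$\begin{cases}\langle\omega_i,w(h')\rangle\le\langle\omega_i,h\rangle & \text{for all } w\in W \text{ and } i\in I,\\ \langle\phi_i,h'\rangle=\langle\phi_i,h\rangle & \text{for all } i\in\{n+1,\dots,d\}.\end{cases}$$ -/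

import Mathlib

open scoped TensorProduct

noncomputable section

/-- Generalized Cartan matrices. -/
structure IsGCM {ι : Type*} (A : Matrix ι ι ℤ) : Prop where
  diag : ∀ i, A i i = 2
  nonpos : ∀ i j, i ≠ j → A i j ≤ 0
  zero_iff : ∀ i j, A i j = 0 ↔ A j i = 0

/-- `A` is symmetrizable: `A = D * B` with `D` diagonal and `B` symmetric (over `ℝ`). -/
def IsSymmetrizable {ι : Type*} [Fintype ι] [DecidableEq ι] (A : Matrix ι ι ℤ) : Prop :=
  ∃ (D : ι → ℝ) (B : Matrix ι ι ℝ), B.IsSymm ∧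
    A.map (fun z : ℤ => (z : ℝ)) = Matrix.diagonal D * B

/-- The entry `m_{ij}` of the Coxeter matrix as a function of `a_{ij} a_{ji}`, for `i ≠ j`;
the value `0` stands for `∞`, as in `CoxeterMatrix`. -/
def coxeterEntry (p : ℤ) : ℕ :=
  if p = 0 then 2 else if p = 1 then 3 else if p = 2 then 4 else if p = 3 then 6 else 0

/-- The Coxeter matrix attached to a square integer matrix. -/
def coxeterMatrixOf {ι : Type*} [DecidableEq ι] (A : Matrix ι ι ℤ) : CoxeterMatrix ι where
  M := Matrix.of fun i j => if i = j then 1 else coxeterEntry (A i j * A j i)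
  isSymm := by
    ext i j
    simp only [Matrix.transpose_apply, Matrix.of_apply, eq_comm (a := j) (b := i),
      mul_comm (A j i)]
  diagonal := by simp
  off_diagonal := by
    intro i j hij
    simp only [Matrix.of_apply, if_neg hij, coxeterEntry]
    split_ifs <;> decide

/-- A Kac-Moody root datum `(ι, A, Λ, (c_i), (h_i))`, where the lattice `Λ` is a free `ℤ`-module of
finite rank, `c_i ∈ Λ`, `h_i ∈ Λ^∨` and `⟨c_j, h_i⟩ = a_{ij}`. -/
structure KacMoodyRootDatum (ι : Type*) [Fintype ι] (Λ : Type*) [AddCommGroup Λ]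
    [Module.Free ℤ Λ] [Module.Finite ℤ Λ] where
  A : Matrix ι ι ℤ
  isGCM : IsGCM A
  c : ι → Λ
  h : ι → Module.Dual ℤ Λ
  pairing : ∀ i j, h i (c j) = A i j

namespace KacMoodyRootDatum

variable {ι : Type*} [Fintype ι] {Λ : Type*} [AddCommGroup Λ]
  [Module.Free ℤ Λ] [Module.Finite ℤ Λ] (D : KacMoodyRootDatum ι Λ)

/-- The `c_i` are linearly independent. -/
def IsFree : Prop := LinearIndependent ℤ D.c

/-- The `h_i` are linearly independent. -/
def IsCofree : Prop := LinearIndependent ℤ D.h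

/-- The real Cartan subalgebra `𝔞 = ℝ ⊗ Λ^∨`. -/
abbrev Cartan (_ : KacMoodyRootDatum ι Λ) : Type _ := ℝ ⊗[ℤ] Module.Dual ℤ Λ

/-- The real-linear functional on `𝔞` given by `⟨l, ·⟩` for `l ∈ Λ`. -/
def functional (l : Λ) : Module.Dual ℝ D.Cartan :=
  Module.Dual.baseChange ℝ (Module.Dual.eval ℤ Λ l)

@[simp]
theorem functional_tmul (l : Λ) (r : ℝ) (x : Module.Dual ℤ Λ) :
    D.functional l (r ⊗ₜ[ℤ] x) = (x l : ℝ) * r := by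
  simp [functional]

/-- The simple root `α_i`, viewed as a functional on `𝔞`. -/
def root (i : ι) : Module.Dual ℝ D.Cartan := D.functional (D.c i)

/-- The simple coroot `α_i^∨`, viewed as an element of `𝔞`. -/
def coroot (i : ι) : D.Cartan := (1 : ℝ) ⊗ₜ[ℤ] D.h i

theorem root_coroot (i j : ι) : D.root j (D.coroot i) = (D.A i j : ℝ) := by
  simp [root, coroot, D.pairing]

/-- The simple reflection `x ↦ x - ⟨α_i, x⟩ α_i^∨` of `𝔞`. This is the dual of the reflection
`l ↦ l - ⟨l, h_i⟩ c_i` of `Λ`. -/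
def simpleReflection (i : ι) : Module.End ℝ D.Cartan :=
  Module.preReflection (D.coroot i) (D.root i)

theorem simpleReflection_apply (i : ι) (x : D.Cartan) :
    D.simpleReflection i x = x - D.root i x • D.coroot i := rfl

variable [DecidableEq ι]

/-- The Weyl group: the Coxeter group with generators `s_i` and relations
`(s_i s_j)^{m_{ij}} = 1`. -/
abbrev WeylGroup : Type _ := (coxeterMatrixOf D.A).Group

/-- The simple reflections of `𝔞` satisfy the defining relations of the Weyl group. -/
theorem isLiftable_simpleReflection :
    (coxeterMatrixOf D.A).IsLiftable D.simpleReflection := by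
  intro i j
  have key : ∀ v : D.Cartan, (D.simpleReflection i * D.simpleReflection j) v =
      v + ((D.A j i : ℝ) * D.root j v - D.root i v) • D.coroot i
        - D.root j v • D.coroot j := by
    intro v
    simp only [Module.End.mul_apply, simpleReflection_apply, map_sub, map_smul, root_coroot]
    module
  have hii : (D.A i i : ℝ) = 2 := by exact_mod_cast D.isGCM.diag i
  have hjj : (D.A j j : ℝ) = 2 := by exact_mod_cast D.isGCM.diag j
  by_cases hij : i = j
  · subst hij
    have : coxeterMatrixOf D.A i i = 1 := (coxeterMatrixOf D.A).diagonal i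
    rw [this, pow_one]
    refine LinearMap.ext fun v => ?_
    rw [key, hii, Module.End.one_apply]
    module
  · have hm : coxeterMatrixOf D.A i j = coxeterEntry (D.A i j * D.A j i) := by
      show (if i = j then 1 else coxeterEntry (D.A i j * D.A j i)) = _
      rw [if_neg hij]
    rw [hm]
    have h1 := D.isGCM.nonpos i j hij
    have h2 := D.isGCM.nonpos j i (Ne.symm hij)
    have h0 := D.isGCM.zero_iff i j
    generalize hp : D.A i j * D.A j i = p
    refine LinearMap.ext fun v => ?_
    unfold coxeterEntry
    split_ifs with c0 c1 c2 c3
    · have hb : D.A i j = 0 ∧ D.A j i = 0 := by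
        rcases mul_eq_zero.mp (hp.trans c0) with h | h
        · exact ⟨h, h0.mp h⟩
        · exact ⟨h0.mpr h, h⟩
      simp only [pow_succ, pow_zero, one_mul, Module.End.mul_apply (_ * _) (_ * _), key, map_add,
        map_sub, map_smul, root_coroot, hii, hjj, hb, smul_eq_mul, Module.End.one_apply]
      push_cast
      module
    on_goal 4 => rw [pow_zero]
    all_goals
      have hb : D.A i j = -1 ∧ D.A j i = -p ∨ D.A i j = -p ∧ D.A j i = -1 := by
        have e1 : D.A i j ≤ -1 := by
          rcases h1.lt_or_eq with h | h
          · omega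
          · exact absurd (by rw [← hp, h, zero_mul]) c0
        have e2 : D.A j i ≤ -1 := by
          rcases h2.lt_or_eq with h | h
          · omega
          · exact absurd (by rw [← hp, h, mul_zero]) c0
        have e3 : -3 ≤ D.A i j := by nlinarith
        have e4 : -3 ≤ D.A j i := by nlinarith
        generalize D.A i j = a at *
        generalize D.A j i = b at *
        interval_cases a <;> interval_cases b <;> omega
      clear h0 h1 h2 hm hp
      subst p
      rcases hb with hb | hb <;>
      · simp only [pow_succ, pow_zero, one_mul, Module.End.mul_apply (_ * _) (_ * _), key,
          map_add, map_sub, map_smul, root_coroot, hii, hjj, hb, smul_eq_mul,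
          Module.End.one_apply]
        push_cast
        module

/-- The linear representation of the Weyl group on `𝔞`, where the generator `s_i` acts by the
simple reflection. -/
def weylRep : Representation ℝ D.WeylGroup D.Cartan :=
  (coxeterMatrixOf D.A).toCoxeterSystem.lift
    ⟨D.simpleReflection, D.isLiftable_simpleReflection⟩

/-- The open fundamental chamber `C`. -/
def openChamber : Set D.Cartan := {x | ∀ i, 0 < D.root i x}

/-- `Ξ_h`, the convex hull of the Weyl group orbit of `h`. -/
def orbitHull (x : D.Cartan) : Set D.Cartan :=
  convexHull ℝ (Set.range fun w : D.WeylGroup => D.weylRep w x)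

end KacMoodyRootDatum

end

/-! ### Affine moves on the space of coroot coefficients

Relative to a base point `h` of the Cartan subalgebra, `h - ∑ i, c i • α_i^∨` is recorded by
the coefficient vector `c`.  The simple reflections become affine moves of the coefficients, which
depend only on the matrix `A` and on the numbers `b j = ⟨α_j, h⟩`. -/

namespace CorootCoeff

open CoxeterSystem (alternatingWord alternatingWord_succ alternatingWord_succ'
  length_alternatingWord)

noncomputable section

set_option linter.unusedSectionVars false

variable {ι : Type*} [Fintype ι] [DecidableEq ι] (A : Matrix ι ι ℤ) (b : ι → ℝ)

/-! Writing a point as `h - ∑ c_i α_i^∨` turns the conditions on the `ω_i` into: every Weyl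
translate of `c` has nonnegative coordinates. Such `c` form the set `admissible`, and the claim
becomes that `admissible` is the convex hull of the orbit of `0`.

One inclusion is positivity of coroots. If `w s_i` is not shorter than `w`, then `w α_i^∨` is a
nonnegative combination of simple coroots; hence (`exists_word_eq`) `w` changes a point by
nonnegative integral multiples of its root values. So `0` is admissible, and `admissible` is convex
and Weyl-invariant.

For the converse, Hahn–Banach first gives equality up to closure (`admissible_subset_closure`): a
separating functional, slightly perturbed, attains its maximum on the orbit, and after translation
it is maximal at `0`, where it is nonpositive on all simple coroots. As the hull has nonempty
interior, it contains the interior of `admissible`.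

The closure is then removed. A dominant point with all coefficients positive is interior to
`admissible` (`mem_interior_admissible`); here symmetrizability enters, since the simple roots
vanishing at the point span a positive definite subsystem, whose Weyl orbits are bounded. An
arbitrary admissible point is moved by reflections towards a dominant limit
(`exists_tendsto_dominant`). On the support of the limit the sequence enters the interior after
finitely many steps, and off the support it becomes exactly zero. So some translate of the point,
hence the point itself, lies in the hull. -/

/-- The value of the simple root `α_j` at the point with coefficients `c`. -/
def slack (c : ι → ℝ) (j : ι) : ℝ := b j - ∑ i, c i * (A i j : ℝ)

/-- The simple reflection `s_j` on the span of the simple coroots. -/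
def coreflection (j : ι) : (ι → ℝ) →ₗ[ℝ] (ι → ℝ) where
  toFun v := v + slack A 0 v j • Pi.single j 1
  map_add' v w := by
    ext k
    simp [slack, add_mul, Finset.sum_add_distrib]
    ring
  map_smul' r v := by
    ext k
    simp [slack, mul_assoc, ← Finset.mul_sum]
    ring

/-- The simple reflection `s_j` acting on coefficient vectors. -/
def move (j : ι) : (ι → ℝ) →ᵃ[ℝ] (ι → ℝ) where
  toFun c := c + slack A b c j • Pi.single j 1
  linear := coreflection A j
  map_vadd' c v := by
    ext k
    simp [coreflection, slack, add_mul, Finset.sum_add_distrib]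
    ring

theorem move_apply (j : ι) (c : ι → ℝ) :
    move A b j c = c + slack A b c j • Pi.single j 1 := rfl

theorem coreflection_apply (j : ι) (v : ι → ℝ) :
    coreflection A j v = v + slack A 0 v j • Pi.single j 1 := rfl

/-- The action of a word in the simple reflections on coefficient vectors. -/
def word (L : List ι) : (ι → ℝ) →ᵃ[ℝ] (ι → ℝ) := (L.map (move A b)).prod

@[simp] theorem word_nil : word A b [] = 1 := rfl

theorem word_cons (j : ι) (L : List ι) : word A b (j :: L) = move A b j * word A b L := by
  simp [word]

theorem word_append (L M : List ι) : word A b (L ++ M) = word A b L * word A b M := by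
  simp [word]

@[simp] theorem word_singleton (j : ι) : word A b [j] = move A b j := by simp [word]

theorem word_cons_apply (j : ι) (L : List ι) (c : ι → ℝ) :
    word A b (j :: L) c = move A b j (word A b L c) := by
  rw [word_cons]; rfl

theorem word_append_apply (L M : List ι) (c : ι → ℝ) :
    word A b (L ++ M) c = word A b L (word A b M c) := by
  rw [word_append]; rfl

theorem word_nil_linear (v : ι → ℝ) : (word A b []).linear v = v := rfl

theorem word_cons_linear (j : ι) (L : List ι) (v : ι → ℝ) :
    (word A b (j :: L)).linear v = coreflection A j ((word A b L).linear v) := by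
  rw [word_cons]; rfl

theorem word_append_linear (L M : List ι) (v : ι → ℝ) :
    (word A b (L ++ M)).linear v = (word A b L).linear ((word A b M).linear v) := by
  rw [word_append]; rfl

theorem word_add (L : List ι) (c v : ι → ℝ) :
    word A b L (c + v) = word A b L c + (word A b L).linear v := by
  have := (word A b L).map_vadd c v
  simp only [vadd_eq_add] at this
  rw [add_comm c, this, add_comm]

theorem slack_add_smul (c : ι → ℝ) (x : ℝ) (i j : ι) :
    slack A b (c + x • Pi.single i 1) j = slack A b c j - x * A i j := by
  simp [slack, add_mul, Finset.sum_add_distrib, Pi.single_apply]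
  ring

variable {A}

theorem move_move (hA : IsGCM A) (j : ι) : move A b j * move A b j = 1 := by
  ext1 c
  have h2 : (A j j : ℝ) = 2 := by exact_mod_cast hA.diag j
  rw [AffineMap.coe_mul, Function.comp_apply, move_apply A b j (move A b j c), move_apply,
    slack_add_smul, h2, AffineMap.coe_one, id]
  module

theorem word_append_pair (hA : IsGCM A) (L : List ι) (j : ι) :
    word A b (L ++ [j] ++ [j]) = word A b L := by
  rw [word_append, word_append, word_singleton, mul_assoc, move_move b hA, mul_one]

theorem word_reverse_mul (hA : IsGCM A) (L : List ι) :
    word A b L.reverse * word A b L = 1 := by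
  induction L with
  | nil => simp
  | cons j L ih =>
    rw [List.reverse_cons, word_append, word_singleton, word_cons, mul_assoc,
      ← mul_assoc (move A b j), move_move b hA, one_mul, ih]

theorem word_reverse_apply (hA : IsGCM A) (L : List ι) (c : ι → ℝ) :
    word A b L.reverse (word A b L c) = c :=
  congrArg (fun f : (ι → ℝ) →ᵃ[ℝ] (ι → ℝ) => f c) (word_reverse_mul b hA L)

theorem word_apply_reverse (hA : IsGCM A) (L : List ι) (c : ι → ℝ) :
    word A b L (word A b L.reverse c) = c := by
  simpa using word_reverse_apply b hA L.reverse c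

/-! ### Rank two -/

theorem move_left (hA : IsGCM A) (i j : ι) (c : ι → ℝ) (x y : ℝ) :
    move A b i (c + x • Pi.single i 1 + y • Pi.single j 1) =
      c + (slack A b c i - x - A j i * y) • Pi.single i 1 + y • Pi.single j 1 := by
  have h2 : (A i i : ℝ) = 2 := by exact_mod_cast hA.diag i
  rw [move_apply, slack_add_smul, slack_add_smul, h2]
  module

theorem move_right (hA : IsGCM A) (i j : ι) (c : ι → ℝ) (x y : ℝ) :
    move A b j (c + x • Pi.single i 1 + y • Pi.single j 1) =
      c + x • Pi.single i 1 + (slack A b c j - y - A i j * x) • Pi.single j 1 := by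
  have h2 : (A j j : ℝ) = 2 := by exact_mod_cast hA.diag j
  rw [move_apply, slack_add_smul, slack_add_smul, h2]
  module

theorem slack_zero_zero (j : ι) : slack A 0 0 j = 0 := by simp [slack]

theorem coreflection_left (hA : IsGCM A) (i j : ι) (x y : ℝ) :
    coreflection A i (x • Pi.single i 1 + y • Pi.single j 1) =
      (-x - A j i * y) • Pi.single i 1 + y • Pi.single j 1 := by
  have := move_left 0 hA i j 0 x y
  simp only [zero_add, slack_zero_zero, zero_sub] at this
  exact this

theorem coreflection_right (hA : IsGCM A) (i j : ι) (x y : ℝ) :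
    coreflection A j (x • Pi.single i 1 + y • Pi.single j 1) =
      x • Pi.single i 1 + (-y - A i j * x) • Pi.single j 1 := by
  have := move_right 0 hA i j 0 x y
  simp only [zero_add, slack_zero_zero, zero_sub] at this
  exact this

/-- Off-diagonal entries with product at most `3`. -/
theorem entries_of_mul_le_three (hA : IsGCM A) {i j : ι} (hij : i ≠ j) (h : A i j * A j i < 4) :
    (A i j = 0 ∧ A j i = 0) ∨ (A i j = -1 ∧ A j i = -1) ∨ (A i j = -1 ∧ A j i = -2) ∨
      (A i j = -2 ∧ A j i = -1) ∨ (A i j = -1 ∧ A j i = -3) ∨ (A i j = -3 ∧ A j i = -1) := by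
  have h1 := hA.nonpos i j hij
  have h2 := hA.nonpos j i (Ne.symm hij)
  have h0 := hA.zero_iff i j
  generalize A i j = a at *
  generalize A j i = b at *
  by_cases ha : a = 0
  · exact Or.inl ⟨ha, h0.1 ha⟩
  · have hb : b ≠ 0 := fun hb => ha (h0.2 hb)
    have e1 : a ≤ -1 := by omega
    have e2 : b ≤ -1 := by omega
    have e3 : -3 ≤ a := by nlinarith
    have e4 : -3 ≤ b := by nlinarith
    interval_cases a <;> interval_cases b <;> omega

/-- The braid relation between `s_i` and `s_j`. -/
theorem word_alternatingWord_comm (hA : IsGCM A) {i j : ι} (hij : i ≠ j)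
    (h : A i j * A j i < 4) :
    word A b (alternatingWord i j (coxeterEntry (A i j * A j i))) =
      word A b (alternatingWord j i (coxeterEntry (A i j * A j i))) := by
  -- Only the coefficients of `α_i^∨` and `α_j^∨` change, so both sides can be computed as
  -- displacements from `c`, starting at `(0, 0)`.
  have start : ∀ c : ι → ℝ, c = c + (0 : ℝ) • Pi.single i 1 + (0 : ℝ) • Pi.single j 1 := by
    intro c; simp
  rcases entries_of_mul_le_three hA hij h with h | h | h | h | h | h <;>
  · ext1 c
    simp only [coxeterEntry, h.1, h.2]
    norm_num [alternatingWord, word_cons_apply]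
    rw [start c]
    simp only [move_left b hA i j, move_right b hA i j, h.1, h.2]
    push_cast
    congr 1
    · congr 2; ring
    · congr 1; ring

/-- A finite check in types `A₁ × A₁`, `A₂`, `B₂`, `G₂`; coefficients never exceed `3`. The strict
bound is needed: at `n = m_{ij}` the coroot becomes negative. -/
theorem word_alternatingWord_linear_of_lt (hA : IsGCM A) {i j : ι} (hij : i ≠ j)
    (h : A i j * A j i < 4) {n : ℕ} (hn : n < coxeterEntry (A i j * A j i)) :
    ∃ x y : ℕ, (word A b (alternatingWord i j n)).linear (Pi.single i 1) =
      (x : ℝ) • Pi.single i 1 + (y : ℝ) • Pi.single j 1 := by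
  have fin : ∀ (f : ι → ℝ) (x y : ℝ), f = x • Pi.single i 1 + y • Pi.single j 1 →
      (∃ m : ℕ, x = m) → (∃ m : ℕ, y = m) → ∃ x y : ℕ,
      f = (x : ℝ) • Pi.single i 1 + (y : ℝ) • Pi.single j 1 := by
    rintro f _ _ h ⟨x, rfl⟩ ⟨y, rfl⟩
    exact ⟨x, y, h⟩
  suffices H : ∀ v : ι → ℝ, v = (1 : ℝ) • Pi.single i 1 + (0 : ℝ) • Pi.single j 1 →
      ∃ x y : ℕ, (word A b (alternatingWord i j n)).linear v =
        (x : ℝ) • Pi.single i 1 + (y : ℝ) • Pi.single j 1 from H _ (by simp)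
  rintro v rfl
  rcases entries_of_mul_le_three hA hij h with h | h | h | h | h | h <;>
  · simp only [coxeterEntry, h.1, h.2] at hn
    norm_num at hn
    interval_cases n <;>
    · simp only [alternatingWord, List.concat_eq_append, List.cons_append, List.nil_append,
        word_cons_linear, word_nil_linear,
        coreflection_left hA i j, coreflection_right hA i j, h.1, h.2]
      refine fin _ _ _ rfl ?_ ?_ <;>
        first
        | (refine ⟨0, ?_⟩; norm_num; done)
        | (refine ⟨1, ?_⟩; norm_num; done)
        | (refine ⟨2, ?_⟩; norm_num; done)
        | (refine ⟨3, ?_⟩; norm_num; done)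

/-- The inequality in the middle is the induction invariant: the next reflection does not decrease
the coefficient it changes. It passes to the other coefficient exactly because `a_{ij} a_{ji} ≥ 4`.
-/
theorem word_alternatingWord_linear_of_four_le (hA : IsGCM A) {i j : ι} (hij : i ≠ j)
    (h : 4 ≤ A i j * A j i) (n : ℕ) :
    ∃ x y : ℤ, 0 ≤ x ∧ 0 ≤ y ∧ (if Even n then 2 * y ≤ -A i j * x else 2 * x ≤ -A j i * y) ∧
      (word A b (alternatingWord i j n)).linear (Pi.single i 1) =
        (x : ℝ) • Pi.single i 1 + (y : ℝ) • Pi.single j 1 := by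
  have h1 := hA.nonpos i j hij
  have h2 := hA.nonpos j i (Ne.symm hij)
  induction n with
  | zero => exact ⟨1, 0, by simp, le_rfl, by simpa using h1, by
      simp [alternatingWord, word_nil_linear, -word_nil]⟩
  | succ n ih =>
    obtain ⟨x, y, hx, hy, hc, he⟩ := ih
    rw [alternatingWord_succ', word_cons_linear, he]
    by_cases hn : Even n
    · rw [if_pos hn] at hc ⊢
      refine ⟨x, -y - A i j * x, hx, by linarith, ?_, ?_⟩
      · rw [if_neg (by simpa [Nat.even_add_one] using hn)]
        nlinarith [mul_le_mul_of_nonneg_left hc (neg_nonneg.2 h2), mul_le_mul_of_nonneg_right h hx]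
      · rw [coreflection_right hA i j]; push_cast; rfl
    · rw [if_neg hn] at hc ⊢
      refine ⟨-x - A j i * y, y, by linarith, hy, ?_, ?_⟩
      · rw [if_pos (by simpa [Nat.even_add_one] using hn)]
        nlinarith [mul_le_mul_of_nonneg_left hc (neg_nonneg.2 h1), mul_le_mul_of_nonneg_right h hy]
      · rw [coreflection_left hA i j]; push_cast; rfl

end

end CorootCoeff

namespace CorootCoeff

open CoxeterSystem (alternatingWord alternatingWord_succ alternatingWord_succ'
  length_alternatingWord)

noncomputable section

set_option linter.unusedSectionVars false

variable {ι : Type*} [Fintype ι] [DecidableEq ι] {A : Matrix ι ι ℤ} (b : ι → ℝ)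

/-! ### Reduced words and positivity -/

theorem exists_alternatingWord_eq_append (i j : ι) (k m : ℕ) :
    ∃ M : List ι, M.length = k ∧ alternatingWord i j (k + m) = M ++ alternatingWord i j m := by
  induction k with
  | zero => exact ⟨[], rfl, by simp⟩
  | succ k ih =>
    obtain ⟨M, hM, he⟩ := ih
    refine ⟨(if Even (k + m) then j else i) :: M, by simp [hM], ?_⟩
    rw [Nat.add_right_comm, alternatingWord_succ', he, List.cons_append]

/-- A word in two letters either can be shortened or is alternating. -/
theorem eq_alternatingWord_or_exists_shorter (hA : IsGCM A) (i j : ι) (M : List ι)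
    (hM : ∀ x ∈ M, x = i ∨ x = j) :
    (∃ M' : List ι, M'.length < M.length ∧ word A b M' = word A b M) ∨
      (∃ n, M = alternatingWord i j n) ∨ ∃ n, M = alternatingWord j i n := by
  induction M using List.reverseRecOn with
  | nil => exact Or.inr (Or.inl ⟨0, rfl⟩)
  | append_singleton M x ih =>
    have hx : x = i ∨ x = j := hM x (by simp)
    rcases ih fun y hy => hM y (by simp [hy]) with ⟨M', hl, hw⟩ | ⟨n, hn⟩ | ⟨n, hn⟩
    · exact Or.inl ⟨M' ++ [x], by simpa using hl, by rw [word_append, hw, word_append]⟩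
    · rcases hx with rfl | rfl
      · exact Or.inr (Or.inr ⟨n + 1, by rw [hn, alternatingWord_succ, List.concat_eq_append]⟩)
      · rcases n with _ | n
        · exact Or.inr (Or.inl ⟨1, by simp [hn, alternatingWord]⟩)
        · refine Or.inl ⟨alternatingWord x i n, by simp [hn], ?_⟩
          rw [hn, alternatingWord_succ, List.concat_eq_append, word_append_pair b hA]
    · rcases hx with rfl | rfl
      · rcases n with _ | n
        · exact Or.inr (Or.inr ⟨1, by simp [hn, alternatingWord]⟩)
        · refine Or.inl ⟨alternatingWord x j n, by simp [hn], ?_⟩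
          rw [hn, alternatingWord_succ, List.concat_eq_append, word_append_pair b hA]
      · exact Or.inr (Or.inl ⟨n + 1, by rw [hn, alternatingWord_succ, List.concat_eq_append]⟩)

/-- The rank two case of positivity of coroots. -/
theorem word_linear_single_or_exists_shorter (hA : IsGCM A) {i j : ι} (hij : i ≠ j) (M : List ι)
    (hM : ∀ x ∈ M, x = i ∨ x = j) :
    (∃ M' : List ι, M'.length < M.length ∧ word A b M' = word A b M) ∨
      (∃ M' : List ι, M'.length < M.length ∧ word A b M' = word A b (M ++ [i])) ∨
      ∃ x y : ℕ, (word A b M).linear (Pi.single i 1) =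
        (x : ℝ) • Pi.single i 1 + (y : ℝ) • Pi.single j 1 := by
  rcases eq_alternatingWord_or_exists_shorter b hA i j M hM with h | ⟨n, rfl⟩ | ⟨n, rfl⟩
  · exact Or.inl h
  · refine Or.inr ?_
    by_cases hp : A i j * A j i < 4
    · by_cases hn : n < coxeterEntry (A i j * A j i)
      · exact Or.inr (word_alternatingWord_linear_of_lt b hA hij hp hn)
      · have hm : coxeterEntry (A i j * A j i) ≠ 0 := by
          rcases entries_of_mul_le_three hA hij hp with h | h | h | h | h | h <;>
            simp [coxeterEntry, h.1, h.2]
        obtain ⟨m, hm⟩ := Nat.exists_eq_succ_of_ne_zero hm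
        have hc := word_alternatingWord_comm b hA hij hp
        rw [hm] at hn hc
        obtain ⟨k, rfl⟩ := Nat.exists_eq_add_of_le' (not_lt.1 hn)
        obtain ⟨M, hk, he⟩ := exists_alternatingWord_eq_append i j k (m + 1)
        refine Or.inl ⟨M ++ alternatingWord i j m, by simp [hk], ?_⟩
        rw [Nat.succ_eq_add_one, he, word_append, word_append, word_append, hc,
          alternatingWord_succ j i, List.concat_eq_append, mul_assoc,
          ← word_append A b _ [i], word_append_pair b hA]
    · obtain ⟨x, y, hx, hy, -, he⟩ :=
        word_alternatingWord_linear_of_four_le b hA hij (not_lt.1 hp) n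
      lift x to ℕ using hx
      lift y to ℕ using hy
      exact Or.inr ⟨x, y, by simpa using he⟩
  · rcases n with _ | n
    · exact Or.inr (Or.inr ⟨1, 0, by simp [alternatingWord, word_nil_linear, -word_nil]⟩)
    · refine Or.inr (Or.inl ⟨alternatingWord i j n, by simp, ?_⟩)
      rw [alternatingWord_succ, List.concat_eq_append, word_append_pair b hA]

/-- A word of minimal length among those with the same action. -/
def IsReduced (A : Matrix ι ι ℤ) (b : ι → ℝ) (L : List ι) : Prop :=
  ∀ L', word A b L' = word A b L → L.length ≤ L'.length

theorem exists_isReduced (L : List ι) : ∃ L', IsReduced A b L' ∧ word A b L' = word A b L := by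
  classical
  have hex : ∃ n, ∃ L' : List ι, L'.length = n ∧ word A b L' = word A b L := ⟨_, L, rfl, rfl⟩
  obtain ⟨L', hl, hw⟩ := Nat.find_spec hex
  refine ⟨L', fun L'' h => ?_, hw⟩
  rw [hl]
  exact Nat.find_min' hex ⟨L'', rfl, h.trans hw⟩

theorem IsReduced.of_append {L M : List ι} (h : IsReduced A b (L ++ M)) : IsReduced A b L := by
  intro L' hL'
  have := h (L' ++ M) (by rw [word_append, hL', word_append])
  simp only [List.length_append] at this
  omega

/-- If `w s_i` is not shorter than `w`, then `w α_i^∨` is a nonnegative integral combination of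
simple coroots. -/
theorem word_linear_single_of_isReduced (hA : IsGCM A) (L : List ι) (hL : IsReduced A b L) (i : ι)
    (hi : ∀ L', word A b L' = word A b (L ++ [i]) → L.length ≤ L'.length) :
    ∃ n : ι → ℕ, (word A b L).linear (Pi.single i 1) = fun k => (n k : ℝ) := by
  classical
  induction hlen : L.length using Nat.strong_induction_on generalizing L i with
  | _ len ih =>
  rcases List.eq_nil_or_concat L with rfl | ⟨L₀, j, hLdef⟩
  · refine ⟨Pi.single i 1, ?_⟩
    rw [word_nil_linear]
    ext k
    by_cases hk : k = i <;> simp [hk]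
  rw [List.concat_eq_append] at hLdef
  have hij : i ≠ j := by
    rintro rfl
    have := hi L₀ (by rw [hLdef, word_append_pair b hA])
    simp [hLdef] at this
  -- Factor `w = w₁ m` with lengths adding, `m` in the dihedral subgroup of `i, j`, and `w₁` as
  -- short as possible. As `j` is the last letter of `w`, `w₁` is strictly shorter than `w`. By
  -- minimality neither `s_i` nor `s_j` shortens `w₁` on the right, so induction applies to both
  -- coroots, and rank two handles `m`.
  let F : ℕ → Prop := fun k => ∃ L₁ M : List ι, L₁.length = k ∧ word A b (L₁ ++ M) = word A b L ∧
    L₁.length + M.length = L.length ∧ ∀ x ∈ M, x = i ∨ x = j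
  have hF₀ : F L₀.length := ⟨L₀, [j], rfl, by rw [hLdef], by simp [hLdef], by simp⟩
  have hF : ∃ k, F k := ⟨_, hF₀⟩
  obtain ⟨L₁, M, hk, hw, hl, hM⟩ := Nat.find_spec hF
  have hlt : L₁.length < L.length := by
    have := Nat.find_min' hF hF₀
    simp only [hLdef, List.length_append, List.length_singleton]
    omega
  have hred : IsReduced A b L₁ := by
    intro L' hL'
    have := hL (L' ++ M) (by rw [word_append, hL', ← word_append, hw])
    simp only [List.length_append] at this
    omega
  have hmin : ∀ x, x = i ∨ x = j → ∀ L', word A b L' = word A b (L₁ ++ [x]) →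
      L₁.length ≤ L'.length := by
    intro x hx L' hL'
    by_contra! hcon
    have hw' : word A b (L' ++ ([x] ++ M)) = word A b L := by
      rw [← hw, word_append, hL', ← word_append, ← List.append_assoc, word_append,
        word_append_pair b hA, word_append]
    have hge := hL _ hw'
    simp only [List.length_append, List.length_singleton] at hge
    have : F L'.length := ⟨L', [x] ++ M, rfl, hw', by simp; omega, by
      intro y hy
      rcases List.mem_append.1 hy with hy | hy
      · rw [List.mem_singleton.1 hy]; exact hx
      · exact hM y hy⟩
    have := Nat.find_min' hF this
    omega
  obtain ⟨n₁, hn₁⟩ := ih _ (hlen ▸ hlt) L₁ hred i (hmin i (Or.inl rfl)) rfl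
  obtain ⟨n₂, hn₂⟩ := ih _ (hlen ▸ hlt) L₁ hred j (hmin j (Or.inr rfl)) rfl
  rcases word_linear_single_or_exists_shorter b hA hij M hM with ⟨M', hl', hw'⟩ | ⟨M', hl', hw'⟩ |
    ⟨x, y, hxy⟩
  · have := hL (L₁ ++ M') (by rw [word_append, hw', ← word_append, hw])
    simp only [List.length_append] at this hl
    omega
  · have := hi (L₁ ++ M') (by rw [word_append, hw', ← word_append, ← List.append_assoc,
      word_append, hw, ← word_append])
    simp only [List.length_append] at this hl
    omega
  · refine ⟨x • n₁ + y • n₂, ?_⟩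
    rw [← hw, word_append_linear, hxy, map_add, map_smul, map_smul, hn₁, hn₂]
    ext k
    simp

theorem exists_word_eq_of_isReduced (hA : IsGCM A) (L : List ι) (hL : IsReduced A b L) :
    ∃ n : ι → ι → ℕ, ∀ c i, word A b L c i = c i + ∑ j, n i j * slack A b c j := by
  induction L using List.reverseRecOn with
  | nil => exact ⟨0, by simp⟩
  | append_singleton L j ih =>
    obtain ⟨n, hn⟩ := ih (hL.of_append b)
    obtain ⟨m, hm⟩ := word_linear_single_of_isReduced b hA L (hL.of_append b) j fun L' h => by
      have := hL L' h
      simp only [List.length_append] at this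
      omega
    refine ⟨fun i => n i + Pi.single j (m i), fun c i => ?_⟩
    rw [word_append_apply, word_singleton, move_apply, word_add, Pi.add_apply, hn, map_smul, hm]
    have : ∀ k, ((Pi.single j (m i) : ι → ℕ) k : ℝ) * slack A b c k =
        if k = j then m i * slack A b c j else 0 := by
      intro k
      by_cases hk : k = j
      · subst hk; simp
      · simp [hk]
    simp only [Pi.add_apply, Nat.cast_add, add_mul, Finset.sum_add_distrib, this]
    simp
    ring

/-- Every Weyl group element moves a point by a combination of simple coroots whose coefficients
are nonnegative integral combinations of the values of the simple roots. -/
theorem exists_word_eq (hA : IsGCM A) (L : List ι) :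
    ∃ n : ι → ι → ℕ, ∀ c i, word A b L c i = c i + ∑ j, n i j * slack A b c j := by
  obtain ⟨L', hred, hw⟩ := exists_isReduced (A := A) b L
  rw [← hw]
  exact exists_word_eq_of_isReduced b hA L' hred

end

end CorootCoeff

namespace CorootCoeff

noncomputable section

set_option linter.unusedSectionVars false

variable {ι : Type*} [Fintype ι] [DecidableEq ι] {A : Matrix ι ι ℤ} {b : ι → ℝ}

/-! ### The hull of an orbit and the admissible set -/

/-- The Weyl group orbit of the base point. -/
def orbit (A : Matrix ι ι ℤ) (b : ι → ℝ) : Set (ι → ℝ) := Set.range fun L => word A b L 0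

/-- The coefficient vectors all of whose translates are nonnegative. -/
def admissible (A : Matrix ι ι ℤ) (b : ι → ℝ) : Set (ι → ℝ) := {c | ∀ L i, 0 ≤ word A b L c i}

theorem slack_base (j : ι) : slack A b 0 j = b j := by simp [slack]

theorem continuous_slack (j : ι) : Continuous fun c => slack A b c j := by
  unfold slack; fun_prop

theorem continuous_word (L : List ι) : Continuous (word A b L) :=
  (word A b L).continuous_of_finiteDimensional

theorem mem_admissible_of_slack_nonneg (hA : IsGCM A) {c : ι → ℝ} (hc : ∀ i, 0 ≤ c i)
    (hs : ∀ j, 0 ≤ slack A b c j) : c ∈ admissible A b := by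
  intro L i
  obtain ⟨n, hn⟩ := exists_word_eq b hA L
  rw [hn]
  exact add_nonneg (hc i) (Finset.sum_nonneg fun j _ => mul_nonneg (Nat.cast_nonneg _) (hs j))

theorem word_mem_admissible {c : ι → ℝ} (hc : c ∈ admissible A b) (L : List ι) :
    word A b L c ∈ admissible A b := by
  intro M i
  rw [← word_append_apply]
  exact hc _ i

theorem nonneg_of_mem_admissible {c : ι → ℝ} (hc : c ∈ admissible A b) (i : ι) : 0 ≤ c i :=
  hc [] i

theorem isClosed_admissible : IsClosed (admissible A b) := by
  simp only [admissible, Set.ofPred_forall]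
  refine isClosed_iInter fun L => isClosed_iInter fun i => ?_
  exact isClosed_le continuous_const ((continuous_apply i).comp (continuous_word L))

theorem convex_admissible : Convex ℝ (admissible A b) := by
  intro x hx y hy s t hs ht hst L i
  have : word A b L (s • x + t • y) = s • word A b L x + t • word A b L y :=
    Convex.combo_affine_apply hst
  rw [this]
  exact add_nonneg (mul_nonneg hs (hx L i)) (mul_nonneg ht (hy L i))

theorem word_mem_convexHull_range {q c : ι → ℝ}
    (hc : c ∈ convexHull ℝ (Set.range fun M => word A b M q)) (L : List ι) :
    word A b L c ∈ convexHull ℝ (Set.range fun M => word A b M q) := by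
  have : word A b L c ∈ word A b L '' convexHull ℝ (Set.range fun M => word A b M q) :=
    Set.mem_image_of_mem _ hc
  rw [AffineMap.image_convexHull] at this
  refine convexHull_mono ?_ this
  rintro _ ⟨_, ⟨M, rfl⟩, rfl⟩
  exact ⟨L ++ M, word_append_apply A b L M q⟩

theorem closure_convexHull_range_subset_admissible {q : ι → ℝ} (hq : q ∈ admissible A b) :
    closure (convexHull ℝ (Set.range fun M => word A b M q)) ⊆ admissible A b := by
  refine closure_minimal (convexHull_min ?_ convex_admissible) isClosed_admissible
  rintro _ ⟨M, rfl⟩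
  exact word_mem_admissible hq M

theorem zero_mem_admissible (hA : IsGCM A) (hb : ∀ j, 0 < b j) : (0 : ι → ℝ) ∈ admissible A b :=
  mem_admissible_of_slack_nonneg hA (fun _ => le_rfl) fun j => by
    rw [slack_base]; exact (hb j).le

theorem convexHull_orbit_subset_admissible (hA : IsGCM A) (hb : ∀ j, 0 < b j) :
    convexHull ℝ (orbit A b) ⊆ admissible A b :=
  subset_closure.trans (closure_convexHull_range_subset_admissible (zero_mem_admissible hA hb))

/-- Orbit points have coordinates `∑ j, n i j * b j` with natural `n i j`; since `b j > 0`, a bound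
on the sum leaves finitely many `n`. -/
theorem finite_orbit_inter_sum_le (hA : IsGCM A) (hb : ∀ j, 0 < b j) (R : ℝ) :
    (orbit A b ∩ {c | ∑ i, c i ≤ R}).Finite := by
  have hN : ∃ N : ℕ, ∀ j, R / b j ≤ N := by
    choose N hN using fun j => exists_nat_ge (R / b j)
    refine ⟨∑ j, N j, fun j => (hN j).trans ?_⟩
    exact_mod_cast Finset.single_le_sum (f := N) (fun _ _ => Nat.zero_le _) (Finset.mem_univ j)
  obtain ⟨N, hN⟩ := hN
  refine ((Set.finite_Icc (0 : ι → ι → ℕ) fun _ _ => N).image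
    fun n i => ∑ j, (n i j : ℝ) * b j).subset ?_
  rintro _ ⟨⟨L, rfl⟩, hR⟩
  obtain ⟨n, hn⟩ := exists_word_eq b hA L
  have hn0 : ∀ i, word A b L 0 i = ∑ j, (n i j : ℝ) * b j := by
    intro i
    simp [hn, slack_base]
  have hterm : ∀ i j, 0 ≤ (n i j : ℝ) * b j := fun i j =>
    mul_nonneg (Nat.cast_nonneg _) (hb j).le
  refine ⟨n, ⟨fun _ _ => Nat.zero_le _, fun i j => ?_⟩, funext fun i => (hn0 i).symm⟩
  have h1 : (n i j : ℝ) * b j ≤ R := by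
    calc (n i j : ℝ) * b j ≤ ∑ j, (n i j : ℝ) * b j :=
          Finset.single_le_sum (f := fun j => (n i j : ℝ) * b j) (fun j _ => hterm i j)
            (Finset.mem_univ j)
      _ = word A b L 0 i := (hn0 i).symm
      _ ≤ ∑ i, word A b L 0 i :=
          Finset.single_le_sum (f := fun i => word A b L 0 i)
            (fun i _ => by rw [hn0]; exact Finset.sum_nonneg fun j _ => hterm i j)
            (Finset.mem_univ i)
      _ ≤ R := hR
  exact_mod_cast ((le_div_iff₀ (hb j)).2 h1).trans (hN j)

/-! ### Equality up to closure, by separation -/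

theorem linear_nonpos_of_forall_single {f : (ι → ℝ) →ₗ[ℝ] ℝ} (hf : ∀ i, f (Pi.single i 1) ≤ 0)
    {d : ι → ℝ} (hd : ∀ i, 0 ≤ d i) : f d ≤ 0 := by
  rw [LinearMap.pi_apply_eq_sum_univ f d]
  refine Finset.sum_nonpos fun i _ => ?_
  have : (fun j => if i = j then (1 : ℝ) else 0) = Pi.single i 1 := by
    ext j; simp [Pi.single_apply, eq_comm]
  rw [this]
  exact mul_nonpos_of_nonneg_of_nonpos (hd i) (hf i)

theorem admissible_subset_closure (hA : IsGCM A) (hb : ∀ j, 0 < b j) :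
    admissible A b ⊆ closure (convexHull ℝ (orbit A b)) := by
  intro c hc
  by_contra hcon
  obtain ⟨f, u, hfu, hu⟩ := geometric_hahn_banach_closed_point
    (convex_convexHull ℝ (orbit A b)).closure isClosed_closure hcon
  have hfu' : ∀ z ∈ orbit A b, f z < u := fun z hz =>
    hfu z (subset_closure (subset_convexHull ℝ _ hz))
  have hsum : 0 ≤ ∑ i, c i := Finset.sum_nonneg fun i _ => nonneg_of_mem_admissible hc i
  -- Small enough that the perturbed functional `g` still exceeds `u` at `c`. The perturbation
  -- confines the search for a maximum to finitely many orbit points, because `g y ≥ 0` and `f y <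
  -- u` force `∑ y i ≤ u / ε`.
  set ε : ℝ := (f c - u) / (∑ i, c i + 1) with hε
  have hεpos : 0 < ε := div_pos (by linarith) (by linarith)
  have hεle : ε * ∑ i, c i < f c - u := by
    have : ε * (∑ i, c i + 1) = f c - u := div_mul_cancel₀ _ (by linarith)
    linarith
  let g : (ι → ℝ) →ₗ[ℝ] ℝ := f.toLinearMap - ε • ∑ i, LinearMap.proj i
  have hg : ∀ z, g z = f z - ε * ∑ i, z i := by
    intro z; simp [g]
  have h0 : (0 : ι → ℝ) ∈ orbit A b := ⟨[], rfl⟩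
  have hnonneg : ∀ z ∈ orbit A b, 0 ≤ ∑ i, z i := fun z hz =>
    Finset.sum_nonneg fun i _ => nonneg_of_mem_admissible
      (convexHull_orbit_subset_admissible hA hb (subset_convexHull ℝ _ hz)) i
  have hupos : 0 < u := by simpa using hfu' 0 h0
  obtain ⟨z, ⟨hzo, -⟩, hzmax⟩ := (finite_orbit_inter_sum_le hA hb (u / ε)).exists_maximalFor g _
    ⟨0, h0, by simpa using (div_pos hupos hεpos).le⟩
  have hmax : ∀ y ∈ orbit A b, g y ≤ g z := by
    intro y hy
    by_contra! hlt
    have hz0 : 0 ≤ g z := by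
      by_contra! hneg
      have := hzmax (j := 0) ⟨h0, by simpa using (div_pos hupos hεpos).le⟩ (by simpa using hneg.le)
      simp only [map_zero] at this
      linarith
    have hyR : ∑ i, y i ≤ u / ε := by
      rw [le_div_iff₀ hεpos]
      have := hfu' y hy
      rw [hg y] at hlt
      linarith
    exact absurd (hzmax ⟨hy, hyR⟩ hlt.le) (not_le.2 hlt)
  obtain ⟨L, rfl⟩ := hzo
  -- Compare the maximum at `w · 0` with the neighbour `w s_i · 0`, which differs from it by `b i >
  -- 0` times `w α_i^∨`.
  have hsimple : ∀ i, g ((word A b L).linear (Pi.single i 1)) ≤ 0 := by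
    intro i
    have h1 := hmax (word A b (L ++ [i]) 0) ⟨_, rfl⟩
    simp only at h1
    rw [word_append_apply, word_singleton, move_apply, slack_base, word_add, map_add, map_smul,
      map_smul, smul_eq_mul] at h1
    by_contra! hpos
    have := mul_pos (hb i) hpos
    linarith
  have hd := word_mem_admissible hc L.reverse
  have h1 : g c = g (word A b L 0) + g ((word A b L).linear (word A b L.reverse c)) := by
    rw [← map_add, ← word_add, zero_add, word_apply_reverse b hA]
  have h2 := linear_nonpos_of_forall_single (f := g ∘ₗ (word A b L).linear) hsimple
    (nonneg_of_mem_admissible hd)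
  rw [LinearMap.comp_apply] at h2
  have h3 := hfu' (word A b L 0) ⟨L, rfl⟩
  have h4 := mul_nonneg hεpos.le (hnonneg (word A b L 0) ⟨L, rfl⟩)
  rw [hg c, hg (word A b L 0)] at h1
  linarith

/-- The orbit contains `0` and the points `s_i · 0 = b_i e_i`, which span affinely. -/
theorem interior_convexHull_orbit_nonempty (hb : ∀ j, 0 < b j) :
    (interior (convexHull ℝ (orbit A b))).Nonempty := by
  rw [interior_convexHull_nonempty_iff_affineSpan_eq_top]
  have h0 : (0 : ι → ℝ) ∈ orbit A b := ⟨[], rfl⟩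
  rw [AffineSubspace.affineSpan_eq_top_iff_vectorSpan_eq_top_of_nonempty ℝ _ _ ⟨0, h0⟩,
    vectorSpan_eq_span_vsub_set_right ℝ h0, eq_top_iff, ← (Pi.basisFun ℝ ι).span_eq,
    Submodule.span_le]
  rintro _ ⟨i, rfl⟩
  have : b i • (Pi.single i 1 : ι → ℝ) ∈
      Submodule.span ℝ ((fun x => x -ᵥ (0 : ι → ℝ)) '' orbit A b) := by
    refine Submodule.subset_span ⟨_, ⟨[i], rfl⟩, ?_⟩
    simp [move_apply, slack_base]
  have := Submodule.smul_mem _ (b i)⁻¹ this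
  rwa [smul_smul, inv_mul_cancel₀ (hb i).ne', one_smul, ← Pi.basisFun_apply] at this

theorem interior_admissible_subset (hA : IsGCM A) (hb : ∀ j, 0 < b j) :
    interior (admissible A b) ⊆ convexHull ℝ (orbit A b) :=
  (interior_mono (admissible_subset_closure hA hb)).trans <| by
    rw [(convex_convexHull ℝ _).interior_closure_eq_interior_of_nonempty_interior
      (interior_convexHull_orbit_nonempty hb)]
    exact interior_subset

end

end CorootCoeff

namespace CorootCoeff

noncomputable section

set_option linter.unusedSectionVars false

variable {ι : Type*} [Fintype ι] [DecidableEq ι] {A : Matrix ι ι ℤ} {b : ι → ℝ}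

/-! ### Subsystems -/

variable (p : ι → Prop) [DecidablePred p]

/-- Extension by zero, translated by `q`. -/
def embed (q : ι → ℝ) : ({i // p i} → ℝ) →ᵃ[ℝ] (ι → ℝ) where
  toFun v i := q i + if h : p i then v ⟨i, h⟩ else 0
  linear :=
    { toFun := fun v i => if h : p i then v ⟨i, h⟩ else 0
      map_add' := fun v w => by
        ext i; by_cases h : p i <;> simp [h]
      map_smul' := fun r v => by
        ext i; by_cases h : p i <;> simp [h] }
  map_vadd' v w := by
    ext i; by_cases h : p i <;> simp [h]; ring

theorem embed_apply (q : ι → ℝ) (v : {i // p i} → ℝ) (i : ι) :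
    embed p q v i = q i + if h : p i then v ⟨i, h⟩ else 0 := rfl

/-- The submatrix of `A` on the indices satisfying `p`. -/
abbrev subMatrix (A : Matrix ι ι ℤ) : Matrix {i // p i} {i // p i} ℤ :=
  A.submatrix Subtype.val Subtype.val

theorem isGCM_subMatrix (hA : IsGCM A) : IsGCM (subMatrix p A) where
  diag i := hA.diag i
  nonpos i j hij := hA.nonpos i j fun h => hij (Subtype.ext h)
  zero_iff i j := hA.zero_iff i j

theorem slack_embed (q : ι → ℝ) (v : {i // p i} → ℝ) (j : ι) :
    slack A b (embed p q v) j = slack A b q j - ∑ i : {i // p i}, v i * (A i j : ℝ) := by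
  simp only [slack, embed_apply, add_mul, Finset.sum_add_distrib]
  rw [← Fintype.sum_subtype_add_sum_subtype p
    (fun i => (if h : p i then v ⟨i, h⟩ else 0) * (A i j : ℝ))]
  have h1 : ∑ i : {i // ¬p i}, (if h : p i then v ⟨i, h⟩ else 0) * (A i j : ℝ) = 0 :=
    Finset.sum_eq_zero fun i _ => by rw [dif_neg i.2, zero_mul]
  have h2 : ∑ i : {i // p i}, (if h : p i then v ⟨i, h⟩ else 0) * (A i j : ℝ) =
      ∑ i : {i // p i}, v i * (A i j : ℝ) :=
    Finset.sum_congr rfl fun i _ => by rw [dif_pos i.2]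
  rw [h1, h2]
  ring

theorem slack_subMatrix (q : ι → ℝ) (v : {i // p i} → ℝ) (j : {i // p i}) :
    slack (subMatrix p A) (fun j => slack A b q j) v j = slack A b (embed p q v) j := by
  rw [slack_embed]
  rfl

/-- The reflections indexed by `p` preserve the slice through `q`, and act there as the Weyl group
of the submatrix with base point `q`, whose root values are the slacks at `q`. -/
theorem word_map_embed (q : ι → ℝ) (L : List {i // p i}) (v : {i // p i} → ℝ) :
    word A b (L.map Subtype.val) (embed p q v) =
      embed p q (word (subMatrix p A) (fun j => slack A b q j) L v) := by
  induction L with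
  | nil => rfl
  | cons j L ih =>
    rw [List.map_cons, word_cons_apply, ih, word_cons_apply, move_apply, move_apply,
      slack_subMatrix]
    ext i
    by_cases hi : p i
    · by_cases hij : i = j
      · subst hij
        simp [embed_apply, hi, add_assoc]
      · have : (⟨i, hi⟩ : {i // p i}) ≠ j := fun h => hij (congrArg Subtype.val h)
        simp [embed_apply, hi, hij, this]
    · have : i ≠ j := fun h => hi (h ▸ j.2)
      simp [embed_apply, hi, this]

theorem embed_zero (q : ι → ℝ) : embed p q 0 = q := by
  ext i; simp [embed_apply]

theorem image_embed_orbit_subset (q : ι → ℝ) :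
    embed p q '' orbit (subMatrix p A) (fun j => slack A b q j) ⊆
      Set.range fun L => word A b L q := by
  rintro _ ⟨_, ⟨L, rfl⟩, rfl⟩
  exact ⟨L.map Subtype.val, by simp only [← word_map_embed, embed_zero]⟩

theorem embed_mem_convexHull (q : ι → ℝ) {v : {i // p i} → ℝ}
    (hv : v ∈ convexHull ℝ (orbit (subMatrix p A) (fun j => slack A b q j))) :
    embed p q v ∈ convexHull ℝ (Set.range fun L => word A b L q) := by
  have h := Set.mem_image_of_mem (embed p q) hv
  rw [AffineMap.image_convexHull] at h
  exact convexHull_mono (image_embed_orbit_subset p q) h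

theorem embed_mem_closure_convexHull (q : ι → ℝ) {v : {i // p i} → ℝ}
    (hv : v ∈ closure (convexHull ℝ (orbit (subMatrix p A) (fun j => slack A b q j)))) :
    embed p q v ∈ closure (convexHull ℝ (Set.range fun L => word A b L q)) :=
  map_mem_closure (embed p q).continuous_of_finiteDimensional hv
    fun _ => embed_mem_convexHull p q

/-! ### The invariant form -/

variable {D : ι → ℝ}

/-- The invariant bilinear form on the span of the simple coroots. -/
def form (A : Matrix ι ι ℤ) (D : ι → ℝ) : LinearMap.BilinForm ℝ (ι → ℝ) :=
  Matrix.toBilin' (Matrix.of fun i j => (A i j : ℝ) * D j)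

theorem form_apply (v w : ι → ℝ) :
    form A D v w = ∑ i, ∑ j, v i * ((A i j : ℝ) * D j) * w j := by
  simp [form, Matrix.toBilin'_apply]

theorem form_comm (hD : ∀ i j, (A i j : ℝ) * D j = A j i * D i) (v w : ι → ℝ) :
    form A D v w = form A D w v := by
  rw [form_apply, form_apply, Finset.sum_comm]
  refine Finset.sum_congr rfl fun j _ => Finset.sum_congr rfl fun i _ => ?_
  rw [hD i j]; ring

theorem form_single (v : ι → ℝ) (j : ι) :
    form A D v (Pi.single j 1) = -slack A 0 v j * D j := by
  simp [form_apply, slack, Pi.single_apply, Finset.sum_mul, mul_assoc]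

theorem form_coreflection (hA : IsGCM A) (hD : ∀ i j, (A i j : ℝ) * D j = A j i * D i)
    (j : ι) (v : ι → ℝ) :
    form A D (coreflection A j v) (coreflection A j v) = form A D v v := by
  have h2 : (A j j : ℝ) = 2 := by exact_mod_cast hA.diag j
  have h3 : slack A 0 (Pi.single j 1) j = -2 := by
    have := slack_add_smul A 0 0 1 j j
    rw [zero_add, one_smul, slack_zero_zero, h2] at this
    linarith
  rw [coreflection_apply]
  simp only [map_add, map_smul, LinearMap.add_apply, LinearMap.smul_apply, smul_eq_mul]
  rw [form_comm hD (Pi.single j 1) v, form_single, form_single, h3]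
  ring

theorem form_word_linear (hA : IsGCM A) (hD : ∀ i j, (A i j : ℝ) * D j = A j i * D i)
    (L : List ι) (v : ι → ℝ) :
    form A D ((word A b L).linear v) ((word A b L).linear v) = form A D v v := by
  induction L with
  | nil => rfl
  | cons j L ih => rw [word_cons_linear, form_coreflection hA hD, ih]

/-- The form is bounded below by an explicit diagonal form when the matrix is of finite type. -/
theorem sum_le_form_self (hA : IsGCM A) (hD0 : ∀ i, 0 < D i)
    (hD : ∀ i j, (A i j : ℝ) * D j = A j i * D i) {u : ι → ℝ} (hu : ∀ i, 0 < u i) (v : ι → ℝ) :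
    ∑ j, (v j / u j) ^ 2 * (D j * u j * ∑ i, u i * (A i j : ℝ)) ≤ form A D v v := by
  -- In the rescaled variable, the form minus the diagonal one is `-½ ∑ N i j (t i - t j)²`,
  -- nonnegative since off-diagonal `N i j` are nonpositive.
  set t : ι → ℝ := fun i => v i / u i with ht
  set N : ι → ι → ℝ := fun i j => u i * ((A i j : ℝ) * D j) * u j with hN
  have hsymm : ∀ i j, N i j = N j i := fun i j => by simp only [hN]; rw [hD i j]; ring
  have h1 : form A D v v = ∑ i, ∑ j, N i j * (t i * t j) := by
    rw [form_apply]
    refine Finset.sum_congr rfl fun i _ => Finset.sum_congr rfl fun j _ => ?_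
    have := (hu i).ne'
    have := (hu j).ne'
    simp only [hN, ht]
    field_simp
  have h2 : ∑ j, t j ^ 2 * (D j * u j * ∑ i, u i * (A i j : ℝ)) =
      ∑ i, ∑ j, N i j * t j ^ 2 := by
    rw [Finset.sum_comm]
    refine Finset.sum_congr rfl fun j _ => ?_
    rw [Finset.mul_sum, Finset.mul_sum]
    exact Finset.sum_congr rfl fun i _ => by simp only [hN]; ring
  have h3 : ∑ i, ∑ j, N i j * t j ^ 2 = ∑ i, ∑ j, N i j * t i ^ 2 := by
    rw [Finset.sum_comm]
    exact Finset.sum_congr rfl fun i _ => Finset.sum_congr rfl fun j _ => by rw [hsymm]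
  have h4 : ∑ i, ∑ j, N i j * ((t i ^ 2 + t j ^ 2) / 2) ≤ ∑ i, ∑ j, N i j * (t i * t j) := by
    refine Finset.sum_le_sum fun i _ => Finset.sum_le_sum fun j _ => ?_
    by_cases hij : i = j
    · subst hij; apply le_of_eq; ring
    · have hle : N i j ≤ 0 := by
        have : (A i j : ℝ) ≤ 0 := by exact_mod_cast hA.nonpos i j hij
        exact mul_nonpos_of_nonpos_of_nonneg (mul_nonpos_of_nonneg_of_nonpos (hu i).le
          (mul_nonpos_of_nonpos_of_nonneg this (hD0 j).le)) (hu j).le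
      nlinarith [mul_nonneg (neg_nonneg.2 hle) (sq_nonneg (t i - t j))]
  have h5 : ∑ i, ∑ j, N i j * ((t i ^ 2 + t j ^ 2) / 2) = ∑ i, ∑ j, N i j * t j ^ 2 := by
    have : ∑ i, ∑ j, N i j * ((t i ^ 2 + t j ^ 2) / 2) =
        (∑ i, ∑ j, N i j * t i ^ 2 + ∑ i, ∑ j, N i j * t j ^ 2) / 2 := by
      simp only [← Finset.sum_add_distrib, Finset.sum_div]
      exact Finset.sum_congr rfl fun i _ => Finset.sum_congr rfl fun j _ => by ring
    rw [this, ← h3]; ring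
  rw [h1, h2, ← h5]
  exact h4

/-- The hypothesis on `u` makes the invariant form positive definite, so the orbit of `u` lies on a
bounded level set. -/
theorem exists_le_word_linear (hA : IsGCM A) (hD0 : ∀ i, 0 < D i)
    (hD : ∀ i j, (A i j : ℝ) * D j = A j i * D i) {u : ι → ℝ} (hu : ∀ i, 0 < u i)
    (hAu : ∀ j, 0 < ∑ i, u i * (A i j : ℝ)) :
    ∃ C > 0, ∀ (L : List ι) i, -(C * u i) ≤ (word A b L).linear u i := by
  set m : ι → ℝ := fun j => D j * u j * ∑ i, u i * (A i j : ℝ) with hm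
  have hm0 : ∀ j, 0 < m j := fun j => mul_pos (mul_pos (hD0 j) (hu j)) (hAu j)
  set Q := form A D u u with hQ
  have hQ0 : 0 ≤ Q := (Finset.sum_nonneg fun j _ => mul_nonneg (sq_nonneg _) (hm0 j).le).trans
    (sum_le_form_self hA hD0 hD hu u)
  refine ⟨1 + ∑ j, Q / m j, ?_, fun L k => ?_⟩
  · have := Finset.sum_nonneg fun j (_ : j ∈ Finset.univ) => div_nonneg hQ0 (hm0 j).le
    linarith
  · have h1 := sum_le_form_self hA hD0 hD hu ((word A b L).linear u)
    rw [form_word_linear hA hD, ← hQ] at h1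
    set t : ℝ := (word A b L).linear u k / u k with ht
    have h2 : t ^ 2 * m k ≤ Q := (Finset.single_le_sum
      (f := fun j => ((word A b L).linear u j / u j) ^ 2 * m j)
      (fun j _ => mul_nonneg (sq_nonneg _) (hm0 j).le) (Finset.mem_univ k)).trans h1
    have h3 : t ^ 2 ≤ Q / m k := (le_div_iff₀ (hm0 k)).2 h2
    have h4 : Q / m k ≤ ∑ j, Q / m j := Finset.single_le_sum (f := fun j => Q / m j)
      (fun j _ => div_nonneg hQ0 (hm0 j).le) (Finset.mem_univ k)
    have h5 : -(1 + ∑ j, Q / m j) ≤ t := by nlinarith [sq_nonneg (t + 1)]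
    rw [ht, le_div_iff₀ (hu k)] at h5
    linarith

end

end CorootCoeff

namespace CorootCoeff

noncomputable section

set_option linter.unusedSectionVars false

variable {ι : Type*} [Fintype ι] [DecidableEq ι] {A : Matrix ι ι ℤ} {b : ι → ℝ} {D : ι → ℝ}

open Filter Topology

/-! ### Dominant points are interior -/

theorem mem_interior_admissible_of_pos (hA : IsGCM A) {c : ι → ℝ} (hc : ∀ i, 0 < c i)
    (hs : ∀ j, 0 < slack A b c j) : c ∈ interior (admissible A b) := by
  have hopen : IsOpen {c : ι → ℝ | ∀ i, 0 < c i ∧ 0 < slack A b c i} := by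
    simp only [Set.ofPred_forall]
    exact isOpen_iInter_of_finite fun i =>
      (isOpen_lt continuous_const (continuous_apply i)).inter
        (isOpen_lt continuous_const (continuous_slack i))
  refine interior_maximal ?_ hopen fun i => ⟨hc i, hs i⟩
  exact fun d hd => mem_admissible_of_slack_nonneg hA (fun i => (hd i).1.le) fun i => (hd i).2.le

theorem word_eq_self_of_slack_eq_zero {c : ι → ℝ} (h : ∀ j, slack A b c j = 0) (L : List ι) :
    word A b L c = c := by
  induction L with
  | nil => rfl
  | cons j L ih => rw [word_cons_apply, ih, move_apply, h, zero_smul, add_zero]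

/-- Let `J` be the set of simple roots vanishing at `x`, and `u` the restriction of `x` to `J`.
Moving from `x` along `-u` reaches a strictly dominant, hence interior, point `q`; moving slightly
along `+u` stays admissible because the orbit of `u` under the subgroup of `J` is bounded. So `x`
lies strictly between an interior and an admissible point. -/
theorem mem_interior_admissible (hA : IsGCM A) (hD0 : ∀ i, 0 < D i)
    (hD : ∀ i j, (A i j : ℝ) * D j = A j i * D i) (hb : ∀ j, 0 < b j) {x : ι → ℝ}
    (hx : ∀ i, 0 < x i) (hs : ∀ j, 0 ≤ slack A b x j) : x ∈ interior (admissible A b) := by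
  classical
  let p : ι → Prop := fun j => slack A b x j = 0
  let u : {i // p i} → ℝ := fun i => x i
  have hu : ∀ i, 0 < u i := fun i => hx i
  -- Vanishing slack gives `∑ x i * A i j = b j > 0`, and the terms outside `J` are nonpositive.
  have hAu : ∀ j : {i // p i}, 0 < ∑ i : {i // p i}, u i * (A i j : ℝ) := by
    intro j
    have h1 : b j - ∑ i, x i * (A i j : ℝ) = 0 := j.2
    rw [← Fintype.sum_subtype_add_sum_subtype p (fun i => x i * (A i j : ℝ))] at h1
    have h2 : ∑ i : {i // ¬p i}, x i * (A i j : ℝ) ≤ 0 := by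
      refine Finset.sum_nonpos fun i _ => mul_nonpos_of_nonneg_of_nonpos (hx i).le ?_
      exact_mod_cast hA.nonpos i j fun h => i.2 (h ▸ j.2)
    have h3 := hb j
    change 0 < ∑ i : {i // p i}, x i * (A i j : ℝ)
    linarith
  have hslack : ∀ (ε : ℝ) j, slack A b (embed p x (-ε • u)) j =
      slack A b x j + ε * ∑ i : {i // p i}, u i * (A i j : ℝ) := by
    intro ε j
    rw [slack_embed, Finset.mul_sum, sub_eq_add_neg, ← Finset.sum_neg_distrib]
    congr 1
    exact Finset.sum_congr rfl fun i _ => by simp; ring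
  have hcoord : ∀ (ε : ℝ) i, embed p x (-ε • u) i = x i - ε * if p i then x i else 0 := by
    intro ε i
    by_cases hi : p i <;> simp [embed_apply, hi, u]; ring
  obtain ⟨ε, ⟨hpos, hspos⟩, hε⟩ : ∃ ε : ℝ, ((∀ i, 0 < embed p x (-ε • u) i) ∧
      ∀ j, 0 < slack A b (embed p x (-ε • u)) j) ∧ 0 < ε := by
    have h1 : ∀ᶠ ε : ℝ in 𝓝[>] 0, ∀ i, 0 < embed p x (-ε • u) i := by
      refine eventually_all.2 fun i => nhdsWithin_le_nhds ?_
      have hcont : Continuous fun ε : ℝ => embed p x (-ε • u) i := by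
        simp only [hcoord]; fun_prop
      exact hcont.continuousAt.eventually (lt_mem_nhds (by simpa [embed_zero] using hx i))
    have h2 : ∀ᶠ ε : ℝ in 𝓝[>] 0, ∀ j, 0 < slack A b (embed p x (-ε • u)) j := by
      refine eventually_all.2 fun j => ?_
      by_cases hj : p j
      · filter_upwards [self_mem_nhdsWithin] with ε hε
        rw [hslack, show slack A b x j = 0 from hj, zero_add]
        exact mul_pos hε (hAu ⟨j, hj⟩)
      · refine nhdsWithin_le_nhds ?_
        have hcont : Continuous fun ε : ℝ => slack A b (embed p x (-ε • u)) j := by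
          simp only [hslack]; fun_prop
        exact hcont.continuousAt.eventually (lt_mem_nhds (by
          simpa [embed_zero] using lt_of_le_of_ne (hs j) (Ne.symm hj)))
    exact ((h1.and h2).and self_mem_nhdsWithin).exists
  set q := embed p x (-ε • u) with hq
  have hqint : q ∈ interior (admissible A b) := mem_interior_admissible_of_pos hA hpos hspos
  let b' : {i // p i} → ℝ := fun j => slack A b q j
  obtain ⟨C, hC, hbound⟩ := exists_le_word_linear (b := b') (isGCM_subMatrix p hA)
    (fun i => hD0 i) (fun i j => hD i j) hu hAu
  -- Relative to `q`, the point `x` is `ε • u`, fixed by the subgroup of `J`. Translates of `(ε + δ)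
  -- • u` are thus at least `ε u - δ C u = 0`.
  set δ := ε / C with hδ
  have hδ0 : 0 < δ := div_pos hε hC
  have hembed : ∀ r : ℝ, embed p q (r • u) = embed p x ((r - ε) • u) := by
    intro r
    ext i
    by_cases hi : p i <;> simp [hq, embed_apply, hi]; ring
  have hfix : ∀ L, word (subMatrix p A) b' L (ε • u) = ε • u := by
    refine word_eq_self_of_slack_eq_zero fun j => ?_
    rw [slack_subMatrix, hembed, sub_self, zero_smul, embed_zero]
    exact j.2
  have hv : (ε • u + δ • u) ∈ admissible (subMatrix p A) b' := by
    intro L i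
    rw [word_add, hfix, map_smul]
    have h1 := mul_le_mul_of_nonneg_left (hbound L i) hδ0.le
    have h2 : δ * C = ε := div_mul_cancel₀ _ hC.ne'
    simp only [Pi.add_apply, Pi.smul_apply, smul_eq_mul]
    have h3 : δ * -(C * u i) = -(ε * u i) := by rw [← h2]; ring
    linarith
  have hy := closure_convexHull_range_subset_admissible (interior_subset hqint)
    (embed_mem_closure_convexHull p q
      (admissible_subset_closure (isGCM_subMatrix p hA) (fun j => hspos j) hv))
  rw [← add_smul, hembed, add_sub_cancel_left] at hy
  refine convex_admissible.openSegment_interior_self_subset_interior hqint hy ?_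
  have hsum : 0 < ε + δ := add_pos hε hδ0
  refine ⟨δ / (ε + δ), ε / (ε + δ), div_pos hδ0 hsum, div_pos hε hsum, ?_, ?_⟩
  · field_simp; ring
  · ext i
    by_cases hi : p i
    · simp [hq, embed_apply, hi, u]
      field_simp
      ring
    · simp [hq, embed_apply, hi]
      field_simp
      ring

/-! ### Descent to a dominant point -/

/-- Reflect in the simple root with the most negative value. The coefficient sum then drops by
exactly that value's size, so the change bounds every slack from below. -/
theorem exists_descent (A : Matrix ι ι ℤ) (b d : ι → ℝ) :
    ∃ d' : ι → ℝ, (∃ L, d' = word A b L d) ∧ (∀ i, d' i ≤ d i) ∧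
      (∀ i, ∑ k, d' k - ∑ k, d k ≤ slack A b d i) ∧ ∀ i, 0 ≤ slack A b d i → d' i = d i := by
  by_cases h : ∀ i, 0 ≤ slack A b d i
  · exact ⟨d, ⟨[], rfl⟩, fun _ => le_rfl, fun i => by simpa using h i, fun _ _ => rfl⟩
  · push Not at h
    obtain ⟨i₀, hi₀⟩ := h
    have : Nonempty ι := ⟨i₀⟩
    obtain ⟨j, hj⟩ := Finite.exists_min (slack A b d)
    have hj0 : slack A b d j < 0 := (hj i₀).trans_lt hi₀
    refine ⟨word A b [j] d, ⟨[j], rfl⟩, fun i => ?_, fun i => ?_, fun i hi => ?_⟩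
    · rw [word_singleton, move_apply]
      by_cases hij : i = j
      · subst hij; simpa using hj0.le
      · simp [hij]
    · rw [word_singleton, move_apply]
      simpa [Finset.sum_add_distrib, ← Finset.mul_sum] using hj i
    · have hij : i ≠ j := by rintro rfl; exact absurd hi (not_le.2 hj0)
      simp [move_apply, hij]

theorem exists_tendsto_dominant {c : ι → ℝ} (hc : c ∈ admissible A b) :
    ∃ (d : ℕ → ι → ℝ) (x : ι → ℝ), (∀ k, ∃ L, d k = word A b L c) ∧ Tendsto d atTop (𝓝 x) ∧
      (∀ i, 0 ≤ x i) ∧ (∀ i, 0 ≤ slack A b x i) ∧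
      ∀ᶠ k in atTop, ∀ i, 0 < slack A b x i → d k i = x i := by
  choose next hword hle hsum hstay using exists_descent A b
  let d : ℕ → ι → ℝ := fun k => next^[k] c
  have hd : ∀ k, d (k + 1) = next (d k) := fun k => Function.iterate_succ_apply' next k c
  have hdw : ∀ k, ∃ L, d k = word A b L c := by
    intro k
    induction k with
    | zero => exact ⟨[], rfl⟩
    | succ k ih =>
      obtain ⟨L, hL⟩ := ih
      obtain ⟨M, hM⟩ := hword (d k)
      exact ⟨M ++ L, by rw [hd, hM, word_append_apply, hL]⟩
  have hd0 : ∀ k i, 0 ≤ d k i := by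
    intro k i
    obtain ⟨L, hL⟩ := hdw k
    rw [hL]
    exact hc L i
  have hanti : ∀ i, Antitone fun k => d k i := fun i =>
    antitone_nat_of_succ_le fun k => by rw [hd]; exact hle _ i
  let x : ι → ℝ := fun i => ⨅ k, d k i
  have hlim : ∀ i, Tendsto (fun k => d k i) atTop (𝓝 (x i)) := fun i =>
    tendsto_atTop_ciInf (hanti i) ⟨0, by rintro _ ⟨k, rfl⟩; exact hd0 k i⟩
  have hdx : Tendsto d atTop (𝓝 x) := tendsto_pi_nhds.2 hlim
  have hslack : ∀ i, Tendsto (fun k => slack A b (d k) i) atTop (𝓝 (slack A b x i)) := fun i =>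
    ((continuous_slack i).tendsto x).comp hdx
  have hS : Tendsto (fun k => ∑ i, d k i) atTop (𝓝 (∑ i, x i)) :=
    tendsto_finsetSum _ fun i _ => hlim i
  refine ⟨d, x, hdw, hdx, fun i => ge_of_tendsto' (hlim i) fun k => hd0 k i, fun i => ?_, ?_⟩
  · have h1 := (hS.comp (tendsto_add_atTop_nat 1)).sub hS
    rw [sub_self] at h1
    exact le_of_tendsto_of_tendsto' h1 (hslack i) fun k => by
      simp only [Function.comp_apply, hd]
      exact hsum _ i
  · refine eventually_all.2 fun i => ?_
    by_cases hi : 0 < slack A b x i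
    · obtain ⟨N, hN⟩ := eventually_atTop.1 ((hslack i).eventually (lt_mem_nhds hi))
      have hconst : ∀ k ≥ N, d k i = d N i := by
        intro k hk
        induction k, hk using Nat.le_induction with
        | base => rfl
        | succ k hk ih => rw [hd, hstay _ i (hN k hk).le, ih]
      have hxi : x i = d N i := tendsto_nhds_unique (hlim i)
        (tendsto_const_nhds.congr' (eventually_atTop.2 ⟨N, fun k hk => (hconst k hk).symm⟩))
      exact eventually_atTop.2 ⟨N, fun k hk _ => by rw [hconst k hk, hxi]⟩
    · exact Eventually.of_forall fun k h => absurd h hi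

theorem admissible_subset_convexHull_orbit (hA : IsGCM A) (hD0 : ∀ i, 0 < D i)
    (hD : ∀ i j, (A i j : ℝ) * D j = A j i * D i) (hb : ∀ j, 0 < b j) :
    admissible A b ⊆ convexHull ℝ (orbit A b) := by
  classical
  intro c hc
  obtain ⟨d, x, hdw, hdx, hx0, hxs, hev⟩ := exists_tendsto_dominant hc
  let p : ι → Prop := fun i => 0 < x i
  -- Where `x i = 0` the slack is at least `b i > 0`, so that coordinate of the sequence is
  -- eventually exactly `0`.
  have hout : ∀ i, ¬p i → x i = 0 ∧ 0 < slack A b x i := by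
    intro i hi
    have hxi : x i = 0 := le_antisymm (not_lt.1 hi) (hx0 i)
    refine ⟨hxi, ?_⟩
    have : ∑ k, x k * (A k i : ℝ) ≤ 0 := by
      refine Finset.sum_nonpos fun k _ => ?_
      by_cases hk : k = i
      · rw [hk, hxi, zero_mul]
      · exact mul_nonpos_of_nonneg_of_nonpos (hx0 k) (by exact_mod_cast hA.nonpos k i hk)
    have := hb i
    unfold slack
    linarith
  have hext : ∀ y : ι → ℝ, (∀ i, ¬p i → y i = 0) → embed p 0 (fun i => y i) = y := by
    intro y hy
    ext i
    by_cases hi : p i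
    · simp [embed_apply, hi]
    · simp [embed_apply, hi, hy i hi]
  have hint : (fun i : {i // p i} => x i) ∈
      interior (admissible (subMatrix p A) fun j => slack A b 0 j) := by
    refine mem_interior_admissible (D := fun i : {i // p i} => D i) (isGCM_subMatrix p hA)
      (fun i => hD0 i) (fun i j => hD i j) (fun j => by rw [slack_base]; exact hb j)
      (fun i => i.2) fun j => ?_
    rw [slack_subMatrix, hext x fun i hi => (hout i hi).1]
    exact hxs j
  have hrest : Tendsto (fun k => fun i : {i // p i} => d k i) atTop
      (𝓝 fun i : {i // p i} => x i) :=
    tendsto_pi_nhds.2 fun i => (tendsto_pi_nhds.1 hdx) i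
  obtain ⟨k, hk, hk'⟩ := ((hrest.eventually (isOpen_interior.mem_nhds hint)).and hev).exists
  have hmem := embed_mem_convexHull p 0 (interior_admissible_subset (isGCM_subMatrix p hA)
    (fun j => by rw [slack_base]; exact hb j) hk)
  rw [hext (d k) fun i hi => by rw [hk' i (hout i hi).2, (hout i hi).1]] at hmem
  obtain ⟨L, hL⟩ := hdw k
  have := word_mem_convexHull_range hmem L.reverse
  rwa [hL, word_reverse_apply b hA] at this

theorem convexHull_orbit_eq_admissible (hA : IsGCM A) (hsymm : IsSymmetrizable A)
    (hb : ∀ j, 0 < b j) : convexHull ℝ (orbit A b) = admissible A b := by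
  refine (convexHull_orbit_subset_admissible hA hb).antisymm ?_
  obtain ⟨D, B, hB, hAB⟩ := hsymm
  have hent : ∀ i j, (A i j : ℝ) = D i * B i j := by
    intro i j
    have := congrFun (congrFun hAB i) j
    simpa [Matrix.diagonal_mul] using this
  -- The given diagonal may have entries of either sign. Absolute values still symmetrize because
  -- off-diagonal entries of `A` are all nonpositive.
  refine admissible_subset_convexHull_orbit (D := fun i => |D i|) hA (fun i => ?_)
    (fun i j => ?_) hb
  · rw [abs_pos]
    intro h
    have h1 := hent i i
    rw [h, zero_mul, hA.diag i] at h1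
    norm_num at h1
  · by_cases hij : i = j
    · rw [hij]
    · have h1 : (A i j : ℝ) ≤ 0 := by exact_mod_cast hA.nonpos i j hij
      have h2 : (A j i : ℝ) ≤ 0 := by exact_mod_cast hA.nonpos j i (Ne.symm hij)
      rw [← neg_inj, ← neg_mul, ← neg_mul, ← abs_of_nonpos h1, ← abs_of_nonpos h2, ← abs_mul,
        ← abs_mul, hent i j, hent j i, hB.apply i j]
      congr 1
      ring

end

end CorootCoeff

namespace KacMoodyRootDatum

noncomputable section

set_option linter.unusedSectionVars false

variable {ι : Type*} [Fintype ι] [DecidableEq ι] {Λ : Type*} [AddCommGroup Λ]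
  [Module.Free ℤ Λ] [Module.Finite ℤ Λ] (D : KacMoodyRootDatum ι Λ)

/-! ### Transfer to the Cartan subalgebra -/

/-- The point `h - ∑ i, c i • α_i^∨` with coefficients `c` relative to `h`. -/
def ofCoeff (h : D.Cartan) : (ι → ℝ) →ᵃ[ℝ] D.Cartan where
  toFun c := h - ∑ i, c i • D.coroot i
  linear := -Fintype.linearCombination ℝ D.coroot
  map_vadd' c v := by
    simp only [vadd_eq_add, Pi.add_apply, add_smul, Finset.sum_add_distrib, LinearMap.neg_apply,
      Fintype.linearCombination_apply]
    abel

theorem ofCoeff_apply (h : D.Cartan) (c : ι → ℝ) :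
    D.ofCoeff h c = h - ∑ i, c i • D.coroot i := rfl

theorem ofCoeff_zero (h : D.Cartan) : D.ofCoeff h 0 = h := by simp [ofCoeff_apply]

theorem root_ofCoeff (h : D.Cartan) (c : ι → ℝ) (j : ι) :
    D.root j (D.ofCoeff h c) = CorootCoeff.slack D.A (fun j => D.root j h) c j := by
  simp [ofCoeff_apply, CorootCoeff.slack, root_coroot]

theorem simpleReflection_ofCoeff (h : D.Cartan) (c : ι → ℝ) (j : ι) :
    D.simpleReflection j (D.ofCoeff h c) =
      D.ofCoeff h (CorootCoeff.move D.A (fun j => D.root j h) j c) := by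
  rw [simpleReflection_apply, root_ofCoeff, CorootCoeff.move_apply]
  simp only [ofCoeff_apply, Pi.add_apply, Pi.smul_apply, add_smul, Finset.sum_add_distrib]
  simp [Pi.single_apply, sub_sub]

theorem weylRep_wordProd_ofCoeff (h : D.Cartan) (L : List ι) (c : ι → ℝ) :
    D.weylRep ((coxeterMatrixOf D.A).toCoxeterSystem.wordProd L) (D.ofCoeff h c) =
      D.ofCoeff h (CorootCoeff.word D.A (fun j => D.root j h) L c) := by
  induction L with
  | nil => simp
  | cons j L ih =>
    rw [CoxeterSystem.wordProd_cons, map_mul, Module.End.mul_apply, ih,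
      CorootCoeff.word_cons_apply, ← simpleReflection_ofCoeff]
    congr 1

theorem orbitHull_eq_image (h : D.Cartan) :
    D.orbitHull h =
      D.ofCoeff h '' convexHull ℝ (CorootCoeff.orbit D.A fun j => D.root j h) := by
  rw [AffineMap.image_convexHull, orbitHull]
  congr 1
  ext y
  constructor
  · rintro ⟨w, rfl⟩
    obtain ⟨L, rfl⟩ := (coxeterMatrixOf D.A).toCoxeterSystem.wordProd_surjective w
    refine ⟨_, ⟨L, rfl⟩, ?_⟩
    simp only [← weylRep_wordProd_ofCoeff, ofCoeff_zero]
  · rintro ⟨_, ⟨L, rfl⟩, rfl⟩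
    refine ⟨(coxeterMatrixOf D.A).toCoxeterSystem.wordProd L, ?_⟩
    simp only [← weylRep_wordProd_ofCoeff, ofCoeff_zero]

variable {κ : Type*} {D} (𝓑 : Module.Basis (ι ⊕ κ) ℝ D.Cartan)

theorem coord_inl_ofCoeff (h𝓑 : ∀ i, 𝓑 (Sum.inl i) = D.coroot i) (h : D.Cartan) (c : ι → ℝ)
    (i : ι) : 𝓑.coord (Sum.inl i) (D.ofCoeff h c) = 𝓑.coord (Sum.inl i) h - c i := by
  classical
  simp [ofCoeff_apply, ← h𝓑, Finsupp.single_apply]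

theorem coord_inr_ofCoeff (h𝓑 : ∀ i, 𝓑 (Sum.inl i) = D.coroot i) (h : D.Cartan) (c : ι → ℝ)
    (k : κ) : 𝓑.coord (Sum.inr k) (D.ofCoeff h c) = 𝓑.coord (Sum.inr k) h := by
  simp [ofCoeff_apply, ← h𝓑]

theorem eq_ofCoeff (h𝓑 : ∀ i, 𝓑 (Sum.inl i) = D.coroot i) {h h' : D.Cartan}
    (hφ : ∀ k : κ, 𝓑.coord (Sum.inr k) h' = 𝓑.coord (Sum.inr k) h) :
    h' = D.ofCoeff h fun i => 𝓑.coord (Sum.inl i) h - 𝓑.coord (Sum.inl i) h' := by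
  refine 𝓑.ext_elem fun s => ?_
  simp only [← Module.Basis.coord_apply]
  rcases s with i | k
  · rw [coord_inl_ofCoeff 𝓑 h𝓑]; ring
  · rw [coord_inr_ofCoeff 𝓑 h𝓑, hφ]

/-- The `ω_i`-coordinate of a translate is that of `h` minus the translated coefficient, so the
inequalities say that `c` is admissible. -/
theorem ofCoeff_mem_orbitHull_iff (hsymm : IsSymmetrizable D.A)
    (h𝓑 : ∀ i, 𝓑 (Sum.inl i) = D.coroot i) {h : D.Cartan} (hC : h ∈ D.openChamber) (c : ι → ℝ) :
    D.ofCoeff h c ∈ D.orbitHull h ↔ ∀ (w : D.WeylGroup) (i : ι),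
      𝓑.coord (Sum.inl i) (D.weylRep w (D.ofCoeff h c)) ≤ 𝓑.coord (Sum.inl i) h := by
  have hinj : Function.Injective (D.ofCoeff h) := by
    intro c c' he
    ext i
    have := congrArg (𝓑.coord (Sum.inl i)) he
    rw [coord_inl_ofCoeff 𝓑 h𝓑, coord_inl_ofCoeff 𝓑 h𝓑] at this
    linarith
  rw [orbitHull_eq_image, hinj.mem_set_image,
    CorootCoeff.convexHull_orbit_eq_admissible D.isGCM hsymm hC]
  constructor
  · intro hc w i
    obtain ⟨L, rfl⟩ := (coxeterMatrixOf D.A).toCoxeterSystem.wordProd_surjective w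
    rw [weylRep_wordProd_ofCoeff, coord_inl_ofCoeff 𝓑 h𝓑]
    linarith [hc L i]
  · intro hc L i
    have := hc ((coxeterMatrixOf D.A).toCoxeterSystem.wordProd L) i
    rw [weylRep_wordProd_ofCoeff, coord_inl_ofCoeff 𝓑 h𝓑] at this
    linarith

end

end KacMoodyRootDatum

theorem mainTheorem6 {ι κ : Type*} [Fintype ι] [DecidableEq ι]
    {Λ : Type*} [AddCommGroup Λ] [Module.Free ℤ Λ] [Module.Finite ℤ Λ]
    (D : KacMoodyRootDatum ι Λ) (hsymm : IsSymmetrizable D.A)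
    (hfree : D.IsFree) (hcofree : D.IsCofree)
    -- a basis of `𝔞` extending the simple coroots; `ω i = 𝓑.coord (inl i)` and
    -- `φ k = 𝓑.coord (inr k)` make up the dual basis
    (𝓑 : Module.Basis (ι ⊕ κ) ℝ D.Cartan) (h𝓑 : ∀ i, 𝓑 (Sum.inl i) = D.coroot i)
    (h : D.Cartan) (hC : h ∈ D.openChamber) (h' : D.Cartan) :
    h' ∈ D.orbitHull h ↔
      (∀ (w : D.WeylGroup) (i : ι),
        𝓑.coord (Sum.inl i) (D.weylRep w h') ≤ 𝓑.coord (Sum.inl i) h) ∧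
      (∀ k : κ, 𝓑.coord (Sum.inr k) h' = 𝓑.coord (Sum.inr k) h) := by
  constructor
  · intro hmem
    obtain ⟨c, -, rfl⟩ := D.orbitHull_eq_image h ▸ hmem
    exact ⟨(KacMoodyRootDatum.ofCoeff_mem_orbitHull_iff 𝓑 hsymm h𝓑 hC c).1 hmem,
      KacMoodyRootDatum.coord_inr_ofCoeff 𝓑 h𝓑 h c⟩
  · rintro ⟨hω, hφ⟩
    rw [KacMoodyRootDatum.eq_ofCoeff 𝓑 h𝓑 hφ] at hω ⊢
    exact (KacMoodyRootDatum.ofCoeff_mem_orbitHull_iff 𝓑 hsymm h𝓑 hC _).2 hω
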